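/- For $n\ge 1$ let $NC_n$ be the set of non-crossing partitions of $[n]=\{1,\dots,n\}$, i.e. the set partitions $\pi$ of $[n]$ for which there are no two distinct blocks $B,C$ of $\pi$ with $i,k\in B$, $j,l\in C$ and $i<j<k<l$. Order $NC_n$ by refinement; it is a finite graded lattice with rank function $\rho$, least element $\hat 0$ (all blocks singletons) and greatest element $\hat 1$ (one block). Let $\mu$ be its Möbius function, $\mu(NC_n)=\mu(\hat 0,\hat 1)$, and let $$\chi(NC_n,t)=\sum_{x\in NC_n}\mu(\hat 0,x)\,t^{\rho(\hat 1)-\rho(x)}\in\mathbb Z[t]$$ be its characteristic polynomial. Then $\chi(NC_1,t)=1$, and for every $n\ge 2$ $$\chi(NC_n,t)=t\,\chi(NC_{n-1},t)-\sum_{i=1}^{n-1}\chi(NC_i,t)\,\chi(NC_{n-i},t).$$ Moreover, for every $n\ge 1$, $$\mu(NC_n)=\chi(NC_n,0)=(-1)^{n-1}C_{n-1},$$ where $C_m=\frac1{m+1}\binom{2m}{m}$ is the $m$-th Catalan number. -/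

import Mathlib

open Polynomial

/-- The partition `r` of `{0 < 1 < ⋯ < n - 1}` (given as an equivalence relation, whose blocks are
the members of `r.classes`) is non-crossing: there are no two distinct blocks `B`, `C` with
`i, k ∈ B` and `j, l ∈ C` such that `i < j < k < l`. -/
def IsNonCrossing {n : ℕ} (r : Setoid (Fin n)) : Prop :=
  ¬ ∃ B ∈ r.classes, ∃ C ∈ r.classes, B ≠ C ∧
    ∃ i j k l : Fin n, i ∈ B ∧ k ∈ B ∧ j ∈ C ∧ l ∈ C ∧ i < j ∧ j < k ∧ k < l

/-- The poset of non-crossing partitions of an `n`-element chain. The order is the one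
inherited from `Setoid (Fin n)`, which is refinement of partitions: `r ≤ s` iff `r i j`
implies `s i j`, that is, iff every block of `r` is contained in a block of `s`. -/
abbrev NC (n : ℕ) : Type := {r : Setoid (Fin n) // IsNonCrossing r}

theorem isNonCrossing_bot (n : ℕ) : IsNonCrossing (⊥ : Setoid (Fin n)) := by
  rintro ⟨B, ⟨x, rfl⟩, C, -, -, i, j, k, l, hi, hk, -, -, hij, hjk, -⟩
  have h1 : i = x := hi
  have h2 : k = x := hk
  exact absurd (hij.trans hjk) (by rw [h1, h2]; exact lt_irrefl x)

theorem isNonCrossing_top (n : ℕ) : IsNonCrossing (⊤ : Setoid (Fin n)) := by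
  rintro ⟨B, ⟨x, rfl⟩, C, ⟨y, rfl⟩, hne, -⟩
  exact hne rfl

/-- The least element is the partition into singletons, the greatest one has a single block. -/
instance (n : ℕ) : BoundedOrder (NC n) where
  top := ⟨⊤, isNonCrossing_top n⟩
  le_top r := le_top (a := r.1)
  bot := ⟨⊥, isNonCrossing_bot n⟩
  bot_le r := bot_le (a := r.1)

instance (n : ℕ) : Finite (NC n) :=
  Finite.of_injective (fun (r : NC n) (i j : Fin n) => r.1 i j) fun _ _ h =>
    Subtype.ext (Setoid.ext fun i j => iff_of_eq (congrFun (congrFun h i) j))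

noncomputable section

open Classical in
/-- The integer-valued Möbius function of a finite poset. -/
def moebius {L : Type*} [PartialOrder L] [Finite L] (x y : L) : ℤ :=
  letI := Fintype.ofFinite L
  letI : LocallyFiniteOrder L := Fintype.toLocallyFiniteOrder
  IncidenceAlgebra.mu ℤ x y

/-- The rank of `x` in a finite poset: the length of a longest chain whose top element is `x`.
For a graded poset with least element this is the usual rank function. -/
def rank {L : Type*} [PartialOrder L] (x : L) : ℕ := (Order.height x).toNat

open Classical in
/-- The characteristic polynomial `χ(L, t) = ∑ x, μ(0̂, x) t ^ (ρ(1̂) - ρ(x))` of a finite graded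
poset `L` with least and greatest element, as a polynomial in the indeterminate `t = X`. -/
def charPoly (L : Type*) [PartialOrder L] [BoundedOrder L] [Finite L] : ℤ[X] :=
  letI := Fintype.ofFinite L
  ∑ x : L, C (moebius ⊥ x) * X ^ (rank (⊤ : L) - rank x)

end

/-!
Give a block of size `k ≥ 1` the weight `t * (-1) ^ (k - 1) * C_(k - 1)` and a partition the product
of the weights of its blocks. For a partition `x` of a finite linear order with greatest element
`⊤`, let `G(x)` be the sum of the weights of all non-crossing `r ≤ x` (`weightSum`). The proof rests
on one recurrence (`mul_weightSum`):

`t * G(x) = t ^ 2 * G(x restricted to a < ⊤)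
            - ∑ i, G(x restricted to a ≤ i) * G(x restricted to a > i)`,

where `i` runs over the elements other than `⊤` of the block of `⊤` in `x`. The partitions `r`
having `⊤` as a singleton give the first term. In any other `r`, choose an element `i ≠ ⊤` of the block of
`⊤`. Since `r` is non-crossing, no other block reaches across `i`, so `r` is determined by its
restrictions to both sides of the cut after `i`, and conversely any two non-crossing partitions of
the two sides are glued to such an `r` (`glue`, `sum_cut`). If the block of `⊤` has size `k`, the
cuts divide it into sizes `a` and `k - a` for `a = 1, …, k - 1`, and the Catalan recurrence says that the
products of the signed Catalan numbers of the two parts add up to minus that of `k`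
(`sum_weight_of_cut`).

At `t = 1` the recurrence shows by induction that, for `x` non-crossing, `G(x)` is `1` if `x = 0̂`
and `0` otherwise (`weightSum_one`). These are the equations that define the Möbius function, so
`μ(0̂, x)` is the weight of `x` at `t = 1` (`moebius_bot`); for `x = 1̂` this is the signed Catalan
number. As the rank is `n` minus the number of blocks (`rank_nc`), at `t = X` and `x = 1̂` the sum
`G(x)` is `X` times the characteristic polynomial (`X_mul_charPoly`), and the recurrence becomes the
one for characteristic polynomials.
-/

/-! ### The Catalan weight of a block -/

/-- The signed Catalan number `(-1) ^ (k - 1) * C_(k - 1)` attached to a block of size `k`. The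
value `0` at `k = 0` makes the convolution formula below hold without boundary terms. -/
def blockWeight : ℕ → ℤ
  | 0 => 0
  | k + 1 => (-1) ^ k * catalan k

/-- The Catalan convolution `∑ a, c a * c (k - a) = -c k`, valid for `k ≥ 2`. -/
theorem sum_blockWeight_mul (m : ℕ) :
    ∑ k ∈ Finset.range (m + 2), blockWeight (k + 1) * blockWeight (m + 2 - (k + 1)) =
      -blockWeight (m + 2) := by
  rw [Finset.sum_range_succ]
  have h : ∀ k ∈ Finset.range (m + 1), blockWeight (k + 1) * blockWeight (m + 2 - (k + 1)) =
      (-1) ^ m * ((catalan k : ℤ) * catalan (m - k)) := by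
    intro k hk
    have hk' : k ≤ m := by simpa [Nat.lt_succ_iff] using hk
    rw [show m + 2 - (k + 1) = (m - k) + 1 by omega]
    simp only [blockWeight]
    have : (-1 : ℤ) ^ m = (-1) ^ k * (-1) ^ (m - k) := by rw [← pow_add]; congr 1; omega
    rw [this]; ring
  rw [Finset.sum_congr rfl h, ← Finset.mul_sum]
  simp only [blockWeight, catalan_succ, Nat.sub_self, mul_zero, add_zero]
  push_cast
  rw [Finset.sum_range (fun k => (catalan k : ℤ) * catalan (m - k))]
  ring

section Weight

open Classical in
/-- Summing a function of the position of `i` in `S` is summing over all positions. -/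
theorem sum_card_filter_le {α M : Type*} [LinearOrder α] [AddCommMonoid M] (f : ℕ → M)
    (S : Finset α) :
    ∑ i ∈ S, f (S.filter (· ≤ i)).card = ∑ k ∈ Finset.range S.card, f (k + 1) := by
  induction S using Finset.induction_on_max with
  | empty => simp
  | insert a S ha ih =>
    have haS : a ∉ S := fun h => lt_irrefl _ (ha a h)
    rw [Finset.sum_insert haS, Finset.card_insert_of_notMem haS, Finset.sum_range_succ, ← ih,
      add_comm]
    congr 1
    · refine Finset.sum_congr rfl fun i hi => ?_
      rw [Finset.filter_insert, if_neg (not_le.2 (ha i hi))]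
    · rw [Finset.filter_true_of_mem, Finset.card_insert_of_notMem haS]
      intro i hi
      rcases Finset.mem_insert.1 hi with rfl | hi
      · exact le_rfl
      · exact (ha i hi).le

variable {α β : Type} [LinearOrder α] [Fintype α] [LinearOrder β] [Fintype β]
variable {R : Type*} [CommRing R]

/-! ### Multiplicative weights of partitions -/

open Classical in
/-- The block of `r` containing `a`. -/
noncomputable def block {γ : Type} [Fintype γ] (r : Setoid γ) (a : γ) : Finset γ :=
  Finset.univ.filter (r a)

theorem mem_block {γ : Type} [Fintype γ] {r : Setoid γ} {a b : γ} : b ∈ block r a ↔ r a b := by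
  simp [block]

/-- `a` is the largest element of its block. -/
def IsBlockMax (r : Setoid α) (a : α) : Prop := ∀ b, r a b → b ≤ a

open Classical in
/-- The largest elements of the blocks of `r`; they represent the blocks. -/
noncomputable def blockMaxima (r : Setoid α) : Finset α := Finset.univ.filter (IsBlockMax r)

theorem mem_blockMaxima {r : Setoid α} {a : α} : a ∈ blockMaxima r ↔ IsBlockMax r a := by
  simp [blockMaxima]

open Classical in
/-- The contribution of `a` to the weight of `r`: that of its block if `a` is the largest element
of the block, and `1` otherwise. -/
noncomputable def localWeight (t : R) (r : Setoid α) (a : α) : R :=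
  if IsBlockMax r a then t * (blockWeight (block r a).card : R) else 1

/-- The weight of a partition: the product over its blocks `B` of `t * blockWeight #B`. -/
noncomputable def weight (t : R) (r : Setoid α) : R := ∏ a, localWeight t r a

theorem localWeight_of_lt {t : R} {r : Setoid α} {a b : α} (h : r a b) (hab : a < b) :
    localWeight t r a = 1 :=
  if_neg fun H => absurd (H b h) (not_le.2 hab)

theorem localWeight_of_isBlockMax {t : R} {r : Setoid α} {a : α} (h : IsBlockMax r a) :
    localWeight t r a = t * (blockWeight (block r a).card : R) :=
  if_pos h

theorem card_block_comap {γ : Type} [LinearOrder γ] (r : Setoid γ) (f : β ↪o γ) (b : β)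
    (S : Finset γ)
    (hS : ∀ a, a ∈ S ↔ r (f b) a ∧ a ∈ Set.range f) :
    (block (r.comap f) b).card = S.card := by
  rw [← Finset.card_map f.toEmbedding]
  congr 1
  ext a
  rw [hS]
  simp only [Finset.mem_map, mem_block, Setoid.comap_rel]
  constructor
  · rintro ⟨c, hc, rfl⟩
    exact ⟨hc, c, rfl⟩
  · rintro ⟨h, c, rfl⟩
    exact ⟨c, h, rfl⟩

/-- The local weight only sees the block, so it is unchanged by restriction to a union of
blocks. -/
theorem localWeight_comap (t : R) (r : Setoid α) (f : β ↪o α) (b : β)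
    (h : ∀ a, r (f b) a → a ∈ Set.range f) :
    localWeight t (r.comap f) b = localWeight t r (f b) := by
  have h1 : IsBlockMax (r.comap f) b ↔ IsBlockMax r (f b) := by
    constructor
    · intro H a ha
      obtain ⟨c, rfl⟩ := h a ha
      exact f.le_iff_le.2 (H c ha)
    · intro H c hc
      exact f.le_iff_le.1 (H (f c) hc)
  have h2 : (block (r.comap f) b).card = (block r (f b)).card :=
    card_block_comap r f b _ fun a => by
      rw [mem_block]; exact ⟨fun H => ⟨H, h a H⟩, fun H => H.1⟩
  by_cases H : IsBlockMax r (f b)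
  · rw [localWeight_of_isBlockMax H, localWeight_of_isBlockMax (h1.2 H), h2]
  · rw [localWeight, if_neg (h1.not.2 H), localWeight, if_neg H]

theorem weight_comap_orderIso (t : R) (r : Setoid α) (e : β ≃o α) :
    weight t (r.comap e) = weight t r := by
  unfold weight
  rw [← e.toEquiv.prod_comp]
  exact Finset.prod_congr rfl fun b _ =>
    localWeight_comap t r e.toOrderEmbedding b fun a _ => e.surjective a

theorem weight_eq_mul_pow (t : R) (r : Setoid α) :
    weight t r = ((weight (1 : ℤ) r : ℤ) : R) * t ^ (blockMaxima r).card := by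
  classical
  have key : ∀ a, localWeight t r a =
      ((localWeight (1 : ℤ) r a : ℤ) : R) * if IsBlockMax r a then t else 1 := by
    intro a
    unfold localWeight
    split_ifs <;> simp [mul_comm]
  unfold weight
  rw [Finset.prod_congr rfl fun a _ => key a, Finset.prod_mul_distrib, Int.cast_prod,
    Finset.prod_ite]
  rw [Finset.prod_const, Finset.prod_const_one, mul_one]
  congr! 3

end Weight

/-! ### Cutting and gluing non-crossing partitions -/

/-- The non-crossing condition for an equivalence relation on an arbitrary linear order. -/
def NonCrossing {α : Type} [LinearOrder α] (r : Setoid α) : Prop :=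
  ∀ ⦃a b c d : α⦄, a < b → b < c → c < d → r a c → r b d → r a b

/-- The restriction of a partition to the elements satisfying `p`. -/
abbrev restrict {α : Type} (p : α → Prop) (r : Setoid α) : Setoid {a // p a} :=
  r.comap Subtype.val

theorem restrict_mono {α : Type} (p : α → Prop) {r s : Setoid α} (h : r ≤ s) :
    restrict p r ≤ restrict p s :=
  fun _ _ hab => h hab

section Glue

variable {α : Type} [LinearOrder α]

theorem NonCrossing.comap {β : Type} [LinearOrder β] {r : Setoid α} (h : NonCrossing r)
    (f : β ↪o α) : NonCrossing (r.comap f) :=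
  fun _ _ _ _ hab hbc hcd hac hbd =>
    h (f.lt_iff_lt.2 hab) (f.lt_iff_lt.2 hbc) (f.lt_iff_lt.2 hcd) hac hbd

theorem NonCrossing.restrict {r : Setoid α} (h : NonCrossing r) (p : α → Prop) :
    NonCrossing (restrict p r) :=
  h.comap (OrderEmbedding.subtype p)

/-- To compare two partitions it suffices to look on each side of the cut and across
it. -/
theorem setoid_ext_of_cut {i : α} {r s : Setoid α} (h1 : ∀ a b, a ≤ i → b ≤ i → (r a b ↔ s a b))
    (h2 : ∀ a b, ¬ a ≤ i → ¬ b ≤ i → (r a b ↔ s a b))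
    (h3 : ∀ a b, a ≤ i → ¬ b ≤ i → (r a b ↔ s a b)) : r = s := by
  refine Setoid.ext fun a b => ?_
  by_cases ha : a ≤ i <;> by_cases hb : b ≤ i
  · exact h1 a b ha hb
  · exact h3 a b ha hb
  · exact ⟨fun h => s.symm ((h3 b a hb ha).1 (r.symm h)),
      fun h => r.symm ((h3 b a hb ha).2 (s.symm h))⟩
  · exact h2 a b ha hb

variable [OrderTop α]

/-- If `i` lies in the block of `⊤`, no other block has elements on both sides of the cut
after `i`. -/
theorem NonCrossing.rel_top_of_le_of_lt {r : Setoid α} (h : NonCrossing r) {i a b : α}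
    (hi : r i ⊤) (ha : a ≤ i) (hb : i < b) (hab : r a b) : r a ⊤ := by
  rcases ha.eq_or_lt with rfl | ha
  · exact hi
  rcases (le_top : b ≤ ⊤).eq_or_lt with rfl | hb'
  · exact hab
  exact r.trans (h ha hb hb' hab hi) hi

open Classical in
/-- Labels for the blocks of the glued partition: the blocks of `u` and of `v`, except that the
block of `i` gets the label of the block of `⊤`. -/
noncomputable def glueLabel {i : α} (hi : ¬ ⊤ ≤ i) (u : Setoid {a // a ≤ i})
    (v : Setoid {a // ¬ a ≤ i}) (a : α) : Quotient u ⊕ Quotient v :=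
  if h : a ≤ i then
    if u ⟨a, h⟩ ⟨i, le_rfl⟩ then Sum.inr (Quotient.mk v ⟨⊤, hi⟩)
    else Sum.inl (Quotient.mk u ⟨a, h⟩)
  else Sum.inr (Quotient.mk v ⟨a, h⟩)

/-- The partition obtained from `u` below the cut after `i` and `v` above it by merging the block
of `i` in `u` with the block of `⊤` in `v`. -/
noncomputable def glue {i : α} (hi : ¬ ⊤ ≤ i) (u : Setoid {a // a ≤ i})
    (v : Setoid {a // ¬ a ≤ i}) : Setoid α :=
  Setoid.ker (glueLabel hi u v)

variable {i : α} (hi : ¬ ⊤ ≤ i) (u : Setoid {a // a ≤ i}) (v : Setoid {a // ¬ a ≤ i})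

theorem glue_rel_of_le {a b : α} (ha : a ≤ i) (hb : b ≤ i) :
    glue hi u v a b ↔ u ⟨a, ha⟩ ⟨b, hb⟩ := by
  unfold glue
  rw [Setoid.ker_def, glueLabel, glueLabel, dif_pos ha, dif_pos hb]
  split_ifs with h1 h2 h2
  · exact iff_of_true rfl (u.trans h1 (u.symm h2))
  · exact iff_of_false (by simp) fun h => h2 (u.trans (u.symm h) h1)
  · exact iff_of_false (by simp) fun h => h1 (u.trans h h2)
  · rw [Sum.inl.injEq]; exact Quotient.eq

theorem glue_rel_of_not_le {a b : α} (ha : ¬ a ≤ i) (hb : ¬ b ≤ i) :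
    glue hi u v a b ↔ v ⟨a, ha⟩ ⟨b, hb⟩ := by
  unfold glue
  rw [Setoid.ker_def, glueLabel, glueLabel, dif_neg ha, dif_neg hb, Sum.inr.injEq]
  exact Quotient.eq

theorem glue_rel_of_le_of_not_le {a b : α} (ha : a ≤ i) (hb : ¬ b ≤ i) :
    glue hi u v a b ↔ u ⟨a, ha⟩ ⟨i, le_rfl⟩ ∧ v ⟨b, hb⟩ ⟨⊤, hi⟩ := by
  unfold glue
  rw [Setoid.ker_def, glueLabel, glueLabel, dif_pos ha, dif_neg hb]
  split_ifs with h1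
  · rw [Sum.inr.injEq, eq_comm, and_iff_right h1]
    exact Quotient.eq
  · exact iff_of_false (by simp) fun h => h1 h.1

theorem glue_rel_top : glue hi u v i ⊤ :=
  (glue_rel_of_le_of_not_le hi u v le_rfl hi).2 ⟨u.refl _, v.refl _⟩

theorem restrict_le_glue : restrict (· ≤ i) (glue hi u v) = u :=
  Setoid.ext fun a b => glue_rel_of_le hi u v a.2 b.2

theorem restrict_not_le_glue : restrict (¬ · ≤ i) (glue hi u v) = v :=
  Setoid.ext fun a b => glue_rel_of_not_le hi u v a.2 b.2

theorem glue_restrict {r : Setoid α} (h : NonCrossing r) (hr : r i ⊤) :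
    glue hi (restrict (· ≤ i) r) (restrict (¬ · ≤ i) r) = r := by
  refine setoid_ext_of_cut (i := i) (fun a b ha hb => glue_rel_of_le hi _ _ ha hb)
    (fun a b ha hb => glue_rel_of_not_le hi _ _ ha hb) fun a b ha hb => ?_
  rw [glue_rel_of_le_of_not_le hi _ _ ha hb]
  simp only [Setoid.comap_rel]
  constructor
  · rintro ⟨h1, h2⟩
    exact r.trans h1 (r.trans hr (r.symm h2))
  · intro hab
    have := h.rel_top_of_le_of_lt hr ha (not_le.1 hb) hab
    exact ⟨r.trans this (r.symm hr), r.trans (r.symm hab) this⟩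

theorem glue_le {s : Setoid α} (hs : s i ⊤) (hu : u ≤ restrict (· ≤ i) s)
    (hv : v ≤ restrict (¬ · ≤ i) s) : glue hi u v ≤ s := by
  have cross : ∀ {a b}, a ≤ i → ¬ b ≤ i → glue hi u v a b → s a b := by
    intro a b ha hb hab
    obtain ⟨h1, h2⟩ := (glue_rel_of_le_of_not_le hi u v ha hb).1 hab
    exact s.trans (hu h1) (s.trans hs (s.symm (hv h2)))
  intro a b hab
  by_cases ha : a ≤ i <;> by_cases hb : b ≤ i
  · exact hu ((glue_rel_of_le hi u v ha hb).1 hab)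
  · exact cross ha hb hab
  · exact s.symm (cross hb ha ((glue hi u v).symm hab))
  · exact hv ((glue_rel_of_not_le hi u v ha hb).1 hab)

variable {u v}

theorem NonCrossing.glue (hu : NonCrossing u) (hv : NonCrossing v) :
    NonCrossing (glue hi u v) := by
  intro a b c d hab hbc hcd hac hbd
  by_cases hd : d ≤ i
  · have hc := hcd.le.trans hd
    have hb := hbc.le.trans hc
    have ha := hab.le.trans hb
    rw [glue_rel_of_le hi u v ha hc] at hac
    rw [glue_rel_of_le hi u v hb hd] at hbd
    rw [glue_rel_of_le hi u v ha hb]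
    exact hu (a := ⟨a, ha⟩) (b := ⟨b, hb⟩) (c := ⟨c, hc⟩) (d := ⟨d, hd⟩) hab hbc hcd hac hbd
  by_cases hb : b ≤ i
  · have ha := hab.le.trans hb
    rw [glue_rel_of_le_of_not_le hi u v hb hd] at hbd
    rw [glue_rel_of_le hi u v ha hb]
    by_cases hc : c ≤ i
    · rw [glue_rel_of_le hi u v ha hc] at hac
      rcases hc.eq_or_lt with rfl | hc'
      · exact u.trans hac (u.symm hbd.1)
      · exact hu (a := ⟨a, ha⟩) (b := ⟨b, hb⟩) (c := ⟨c, hc⟩) (d := ⟨i, le_rfl⟩)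
          hab hbc hc' hac hbd.1
    · rw [glue_rel_of_le_of_not_le hi u v ha hc] at hac
      exact u.trans hac.1 (u.symm hbd.1)
  have hc : ¬ c ≤ i := fun h => hb (hbc.le.trans h)
  rw [glue_rel_of_not_le hi u v hb hd] at hbd
  by_cases ha : a ≤ i
  · rw [glue_rel_of_le_of_not_le hi u v ha hc] at hac
    rw [glue_rel_of_le_of_not_le hi u v ha hb]
    refine ⟨hac.1, ?_⟩
    rcases (le_top : d ≤ ⊤).eq_or_lt with rfl | hd'
    · exact hbd
    · exact v.trans (hv (a := ⟨b, hb⟩) (b := ⟨c, hc⟩) (c := ⟨d, hd⟩) (d := ⟨⊤, hi⟩)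
        hbc hcd hd' hbd hac.2) hac.2
  · rw [glue_rel_of_not_le hi u v ha hc] at hac
    rw [glue_rel_of_not_le hi u v ha hb]
    exact hv (a := ⟨a, ha⟩) (b := ⟨b, hb⟩) (c := ⟨c, hc⟩) (d := ⟨d, hd⟩) hab hbc hcd hac hbd

end Glue

section AddSingleton

variable {α : Type} [LinearOrder α] [OrderTop α]

open Classical in
/-- The partition of `α` obtained from a partition of the elements below `⊤` by adding the
singleton block of `⊤`. -/
noncomputable def addTop (u : Setoid {a : α // a < ⊤}) : Setoid α :=
  Setoid.ker fun a => if h : a < ⊤ then some (Quotient.mk u ⟨a, h⟩) else none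

theorem addTop_rel (u : Setoid {a : α // a < ⊤}) {a b : α} (ha : a < ⊤) (hb : b < ⊤) :
    addTop u a b ↔ u ⟨a, ha⟩ ⟨b, hb⟩ := by
  unfold addTop
  rw [Setoid.ker_def, dif_pos ha, dif_pos hb, Option.some.injEq]
  exact Quotient.eq

theorem not_addTop_rel_top (u : Setoid {a : α // a < ⊤}) {a : α} (ha : a < ⊤) :
    ¬ addTop u a ⊤ := by
  unfold addTop
  rw [Setoid.ker_def, dif_pos ha, dif_neg (lt_irrefl _)]
  simp

theorem restrict_addTop (u : Setoid {a : α // a < ⊤}) : restrict (· < ⊤) (addTop u) = u :=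
  Setoid.ext fun a b => addTop_rel u a.2 b.2

theorem addTop_le {u : Setoid {a : α // a < ⊤}} {s : Setoid α} (h : u ≤ restrict (· < ⊤) s) :
    addTop u ≤ s := by
  intro a b hab
  rcases (le_top : a ≤ ⊤).eq_or_lt with rfl | ha <;> rcases (le_top : b ≤ ⊤).eq_or_lt with rfl | hb
  · exact s.refl _
  · exact absurd ((addTop u).symm hab) (not_addTop_rel_top u hb)
  · exact absurd hab (not_addTop_rel_top u ha)
  · exact h ((addTop_rel u ha hb).1 hab)

theorem addTop_restrict {r : Setoid α} (h : ∀ a < ⊤, ¬ r a ⊤) :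
    addTop (restrict (· < ⊤) r) = r := by
  refine le_antisymm (addTop_le le_rfl) fun a b hab => ?_
  rcases (le_top : a ≤ ⊤).eq_or_lt with rfl | ha <;> rcases (le_top : b ≤ ⊤).eq_or_lt with rfl | hb
  · exact (addTop _).refl _
  · exact absurd (r.symm hab) (h b hb)
  · exact absurd hab (h a ha)
  · exact (addTop_rel _ ha hb).2 hab

theorem NonCrossing.addTop {u : Setoid {a : α // a < ⊤}} (hu : NonCrossing u) :
    NonCrossing (addTop u) := by
  intro a b c d hab hbc hcd hac hbd
  have hc : c < ⊤ := hcd.trans_le le_top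
  have hb := hbc.trans hc
  have ha := hab.trans hb
  rcases (le_top : d ≤ ⊤).eq_or_lt with rfl | hd
  · exact absurd hbd (not_addTop_rel_top u hb)
  rw [addTop_rel u ha hc] at hac
  rw [addTop_rel u hb hd] at hbd
  rw [addTop_rel u ha hb]
  exact hu (a := ⟨a, ha⟩) (b := ⟨b, hb⟩) (c := ⟨c, hc⟩) (d := ⟨d, hd⟩) hab hbc hcd hac hbd

end AddSingleton

/-! ### The recurrence for weighted sums over intervals -/

section Recurrence

variable {R : Type*} [CommRing R] {α : Type} [LinearOrder α] [Fintype α]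

instance {γ : Type} [Finite γ] : Finite (Setoid γ) :=
  Finite.of_injective (fun (r : Setoid γ) (i j : γ) => r i j) fun _ _ h =>
    Setoid.ext fun i j => iff_of_eq (congrFun (congrFun h i) j)

/-- The non-crossing partitions refining `x`. The partition `x` itself may have crossings. -/
noncomputable def ncBelow {γ : Type} [LinearOrder γ] [Finite γ] (x : Setoid γ) :
    Finset (Setoid γ) :=
  (Set.toFinite {r | NonCrossing r ∧ r ≤ x}).toFinset

theorem mem_ncBelow {γ : Type} [LinearOrder γ] [Finite γ] {x r : Setoid γ} :
    r ∈ ncBelow x ↔ NonCrossing r ∧ r ≤ x := by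
  simp [ncBelow]

/-- The sum of the weights of the non-crossing partitions refining `x`. -/
noncomputable def weightSum (t : R) (x : Setoid α) : R := ∑ r ∈ ncBelow x, weight t r

theorem weightSum_comap_orderIso {β : Type} [LinearOrder β] [Fintype β] (t : R) (x : Setoid α)
    (e : β ≃o α) : weightSum t (x.comap e) = weightSum t x := by
  refine Finset.sum_nbij' (fun r => r.comap e.symm) (fun r => r.comap e) ?_ ?_ ?_ ?_ ?_
  · intro r hr
    rw [mem_ncBelow] at hr ⊢
    refine ⟨hr.1.comap e.symm.toOrderEmbedding, fun a b hab => ?_⟩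
    simpa [Setoid.comap_rel] using hr.2 hab
  · intro r hr
    rw [mem_ncBelow] at hr ⊢
    exact ⟨hr.1.comap e.toOrderEmbedding, fun a b hab => hr.2 hab⟩
  · intro r _
    ext a b
    simp [Setoid.comap_rel]
  · intro r _
    ext a b
    simp [Setoid.comap_rel]
  · intro r _
    exact (weight_comap_orderIso t r e.symm).symm

variable [OrderTop α]

theorem weight_of_isolated_top (t : R) {r : Setoid α} (h : ∀ a < ⊤, ¬ r a ⊤) :
    weight t r = t * weight t (restrict (· < ⊤) r) := by
  classical
  have htop : localWeight t r ⊤ = t := by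
    have : block r ⊤ = {⊤} := by
      ext a
      rw [mem_block, Finset.mem_singleton]
      refine ⟨fun ha => ?_, fun ha => ha ▸ r.refl _⟩
      by_contra hne
      exact h a (lt_top_iff_ne_top.2 hne) (r.symm ha)
    rw [localWeight_of_isBlockMax fun b _ => le_top, this]
    simp [blockWeight]
  unfold weight
  rw [← Finset.mul_prod_erase Finset.univ _ (Finset.mem_univ ⊤), htop,
    Finset.prod_subtype (p := (· < ⊤)) _ (by simp [lt_top_iff_ne_top])]
  congr 1
  refine Finset.prod_congr rfl fun a _ => ?_
  refine (localWeight_comap t r (OrderEmbedding.subtype (· < (⊤ : α))) a fun b hb => ?_).symm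
  refine ⟨⟨b, lt_top_iff_ne_top.2 ?_⟩, rfl⟩
  rintro rfl
  exact h a a.2 hb

open Classical in
/-- Cutting after an element `i` of the block of `⊤` splits this block in two and leaves the
others intact. -/
theorem weight_mul_weight_of_cut (t : R) {r : Setoid α} (h : NonCrossing r) {i : α}
    (hi : i < ⊤) (hr : r i ⊤) :
    weight t (restrict (· ≤ i) r) * weight t (restrict (¬ · ≤ i) r) =
      (∏ a ∈ Finset.univ.erase ⊤, localWeight t r a) * t ^ 2 *
        ((blockWeight ((block r ⊤).filter (· ≤ i)).card *
          blockWeight ((block r ⊤).card - ((block r ⊤).filter (· ≤ i)).card) : ℤ) : R) := by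
  set f : α → R := fun a => if ha : a ≤ i then localWeight t (restrict (· ≤ i) r) ⟨a, ha⟩
    else localWeight t (restrict (¬ · ≤ i) r) ⟨a, ha⟩ with hf
  have hprod : weight t (restrict (· ≤ i) r) * weight t (restrict (¬ · ≤ i) r) = ∏ a, f a := by
    rw [← Fintype.prod_subtype_mul_prod_subtype (· ≤ i)]
    unfold weight
    congr 1
    · exact Finset.prod_congr rfl fun a _ => by simp only [hf]; rw [dif_pos a.2]
    · exact Finset.prod_congr rfl fun a _ => by simp only [hf]; rw [dif_neg a.2]
  have hi' : ¬ ⊤ ≤ i := not_le.2 hi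
  have hmem : i ∈ Finset.univ.erase (⊤ : α) := by simp [hi.ne]
  have hfi : f i = t * (blockWeight ((block r ⊤).filter (· ≤ i)).card : R) := by
    simp only [hf, le_refl, dite_true]
    rw [localWeight_of_isBlockMax fun b _ => b.2]
    congr 3
    refine card_block_comap r (OrderEmbedding.subtype (· ≤ i)) ⟨i, le_rfl⟩ _ fun a => ?_
    rw [Finset.mem_filter, mem_block]
    constructor
    · rintro ⟨h1, h2⟩
      exact ⟨r.trans hr h1, ⟨a, h2⟩, rfl⟩
    · rintro ⟨h1, b, rfl⟩
      exact ⟨r.trans (r.symm hr) h1, b.2⟩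
  have hft : f ⊤ = t *
      (blockWeight ((block r ⊤).card - ((block r ⊤).filter (· ≤ i)).card) : R) := by
    simp only [hf, hi', dite_false]
    rw [localWeight_of_isBlockMax fun b _ => (le_top : b.1 ≤ ⊤)]
    congr 3
    rw [← Finset.card_filter_add_card_filter_not (s := block r ⊤) (· ≤ i), Nat.add_sub_cancel_left]
    refine card_block_comap r (OrderEmbedding.subtype (¬ · ≤ i)) ⟨⊤, hi'⟩ _ fun a => ?_
    rw [Finset.mem_filter, mem_block]
    constructor
    · rintro ⟨h1, h2⟩
      exact ⟨h1, ⟨a, h2⟩, rfl⟩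
    · rintro ⟨h1, b, rfl⟩
      exact ⟨h1, b.2⟩
  have hrest : ∀ a ∈ (Finset.univ.erase (⊤ : α)).erase i, f a = localWeight t r a := by
    intro a ha
    simp only [Finset.mem_erase, Finset.mem_univ, and_true] at ha
    obtain ⟨hai, hat⟩ := ha
    have hat' : a < ⊤ := lt_top_iff_ne_top.2 hat
    by_cases hle : a ≤ i
    · simp only [hf, hle, dite_true]
      by_cases hrt : r a ⊤
      -- in the divided block, `a` is not the largest element, before or after the cut
      · rw [localWeight_of_lt hrt hat']
        exact localWeight_of_lt (b := ⟨i, le_rfl⟩) (r.trans hrt (r.symm hr))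
          (Subtype.mk_lt_mk.2 (lt_of_le_of_ne hle hai))
      · refine localWeight_comap t r (OrderEmbedding.subtype (· ≤ i)) ⟨a, hle⟩ fun b hb => ?_
        by_contra hb'
        have hbi : ¬ b ≤ i := fun h => hb' ⟨⟨b, h⟩, rfl⟩
        exact hrt (h.rel_top_of_le_of_lt hr hle (not_le.1 hbi) hb)
    · simp only [hf, hle, dite_false]
      by_cases hrt : r a ⊤
      · rw [localWeight_of_lt hrt hat']
        exact localWeight_of_lt (b := ⟨⊤, hi'⟩) hrt hat'
      · refine localWeight_comap t r (OrderEmbedding.subtype (¬ · ≤ i)) ⟨a, hle⟩ fun b hb => ?_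
        by_contra hb'
        have hbi : b ≤ i := by
          by_contra hn
          exact hb' ⟨⟨b, hn⟩, rfl⟩
        exact hrt (r.trans hb (h.rel_top_of_le_of_lt hr hbi (not_le.1 hle) (r.symm hb)))
  rw [hprod, ← Finset.mul_prod_erase Finset.univ _ (Finset.mem_univ ⊤),
    ← Finset.mul_prod_erase _ _ hmem, Finset.prod_congr rfl hrest, hft, hfi,
    ← Finset.mul_prod_erase _ (localWeight t r) hmem, localWeight_of_lt hr hi]
  push_cast
  ring

open Classical in
/-- The Catalan convolution, read as a sum over the places where the block of `⊤` can be cut. -/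
theorem sum_weight_of_cut (t : R) {r : Setoid α} (h : NonCrossing r)
    (hr : ∃ a < ⊤, r a ⊤) :
    ∑ i ∈ (block r ⊤).erase ⊤,
      weight t (restrict (· ≤ i) r) * weight t (restrict (¬ · ≤ i) r) = -(t * weight t r) := by
  have htop : ⊤ ∈ block r ⊤ := mem_block.2 (r.refl _)
  have hcard : 2 ≤ (block r ⊤).card := by
    obtain ⟨a, ha, har⟩ := hr
    exact Finset.one_lt_card.2 ⟨a, mem_block.2 (r.symm har), ⊤, htop, ha.ne⟩
  obtain ⟨m, hm⟩ := Nat.exists_eq_add_of_le' hcard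
  have hsum : ∑ i ∈ (block r ⊤).erase ⊤,
      blockWeight ((block r ⊤).filter (· ≤ i)).card *
        blockWeight ((block r ⊤).card - ((block r ⊤).filter (· ≤ i)).card) =
      -blockWeight (block r ⊤).card := by
    -- the additional term `i = ⊤` vanishes because `blockWeight 0 = 0`
    rw [Finset.sum_erase, sum_card_filter_le fun k => blockWeight k *
      blockWeight ((block r ⊤).card - k), hm, sum_blockWeight_mul]
    rw [Finset.filter_true_of_mem fun _ _ => le_top, Nat.sub_self]
    simp [blockWeight]
  have hcut : ∀ i ∈ (block r ⊤).erase ⊤,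
      weight t (restrict (· ≤ i) r) * weight t (restrict (¬ · ≤ i) r) =
      (∏ a ∈ Finset.univ.erase ⊤, localWeight t r a) * t ^ 2 *
        ((blockWeight ((block r ⊤).filter (· ≤ i)).card *
          blockWeight ((block r ⊤).card - ((block r ⊤).filter (· ≤ i)).card) : ℤ) : R) := by
    intro i hi
    rw [Finset.mem_erase, mem_block] at hi
    exact weight_mul_weight_of_cut t h (lt_top_iff_ne_top.2 hi.1) (r.symm hi.2)
  rw [Finset.sum_congr rfl hcut, ← Finset.mul_sum, ← Int.cast_sum, hsum]
  unfold weight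
  rw [← Finset.mul_prod_erase Finset.univ _ (Finset.mem_univ ⊤),
    localWeight_of_isBlockMax fun b _ => le_top]
  push_cast
  ring

open Classical in
theorem sum_isolated_top (t : R) (x : Setoid α) :
    ∑ r ∈ ncBelow x with ∀ a < ⊤, ¬ r a ⊤, weight t r =
      t * weightSum t (restrict (· < ⊤) x) := by
  unfold weightSum
  rw [Finset.mul_sum]
  refine Finset.sum_nbij' (restrict (· < ⊤)) addTop ?_ ?_ ?_ ?_ ?_
  · intro r hr
    rw [Finset.mem_filter, mem_ncBelow] at hr
    exact mem_ncBelow.2 ⟨hr.1.1.restrict _, restrict_mono _ hr.1.2⟩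
  · intro u hu
    rw [mem_ncBelow] at hu
    rw [Finset.mem_filter, mem_ncBelow]
    exact ⟨⟨hu.1.addTop, addTop_le hu.2⟩, fun a ha => not_addTop_rel_top u ha⟩
  · intro r hr
    exact addTop_restrict (Finset.mem_filter.1 hr).2
  · intro u _
    exact restrict_addTop u
  · intro r hr
    exact weight_of_isolated_top t (Finset.mem_filter.1 hr).2

open Classical in
theorem sum_cut (t : R) {x : Setoid α} {i : α} (hi : i < ⊤) (hx : x i ⊤) :
    ∑ r ∈ ncBelow x with r i ⊤,
        weight t (restrict (· ≤ i) r) * weight t (restrict (¬ · ≤ i) r) =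
      weightSum t (restrict (· ≤ i) x) * weightSum t (restrict (¬ · ≤ i) x) := by
  have hi' : ¬ ⊤ ≤ i := not_le.2 hi
  unfold weightSum
  rw [Finset.sum_mul_sum, ← Finset.sum_product']
  refine Finset.sum_nbij' (fun r => (restrict (· ≤ i) r, restrict (¬ · ≤ i) r))
    (fun p => glue hi' p.1 p.2) ?_ ?_ ?_ ?_ ?_
  · intro r hr
    rw [Finset.mem_filter, mem_ncBelow] at hr
    exact Finset.mem_product.2 ⟨mem_ncBelow.2 ⟨hr.1.1.restrict _, restrict_mono _ hr.1.2⟩,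
      mem_ncBelow.2 ⟨hr.1.1.restrict _, restrict_mono _ hr.1.2⟩⟩
  · intro p hp
    rw [Finset.mem_product, mem_ncBelow, mem_ncBelow] at hp
    rw [Finset.mem_filter, mem_ncBelow]
    exact ⟨⟨NonCrossing.glue hi' hp.1.1 hp.2.1, glue_le hi' _ _ hx hp.1.2 hp.2.2⟩,
      glue_rel_top hi' _ _⟩
  · intro r hr
    rw [Finset.mem_filter, mem_ncBelow] at hr
    exact glue_restrict hi' hr.1.1 hr.2
  · intro p _
    exact Prod.ext (restrict_le_glue hi' _ _) (restrict_not_le_glue hi' _ _)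
  · intro r _
    rfl

open Classical in
/-- The recurrence behind the theorem, over an arbitrary interval `[0̂, x]`. Partitions in which `⊤`
is isolated give the first term; every other partition is traded for the ways of cutting its
block of `⊤` in two. -/
theorem mul_weightSum (t : R) (x : Setoid α) :
    t * weightSum t x = t ^ 2 * weightSum t (restrict (· < ⊤) x) -
      ∑ i ∈ (block x ⊤).erase ⊤,
        weightSum t (restrict (· ≤ i) x) * weightSum t (restrict (¬ · ≤ i) x) := by
  have h1 : ∑ i ∈ (block x ⊤).erase ⊤,
        weightSum t (restrict (· ≤ i) x) * weightSum t (restrict (¬ · ≤ i) x) =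
      ∑ i ∈ (block x ⊤).erase ⊤, ∑ r ∈ ncBelow x with r i ⊤,
        weight t (restrict (· ≤ i) r) * weight t (restrict (¬ · ≤ i) r) := by
    refine Finset.sum_congr rfl fun i hi => ?_
    rw [Finset.mem_erase, mem_block] at hi
    exact (sum_cut t (lt_top_iff_ne_top.2 hi.1) (x.symm hi.2)).symm
  have h2 : ∑ i ∈ (block x ⊤).erase ⊤, ∑ r ∈ ncBelow x with r i ⊤,
        weight t (restrict (· ≤ i) r) * weight t (restrict (¬ · ≤ i) r) =
      ∑ r ∈ ncBelow x with ¬ ∀ a < ⊤, ¬ r a ⊤, ∑ i ∈ (block r ⊤).erase ⊤,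
        weight t (restrict (· ≤ i) r) * weight t (restrict (¬ · ≤ i) r) := by
    refine Finset.sum_comm' fun i r => ?_
    simp only [Finset.mem_erase, mem_block, Finset.mem_filter, mem_ncBelow]
    constructor
    · rintro ⟨⟨hi, -⟩, hr, hir⟩
      exact ⟨⟨hi, r.symm hir⟩, hr, fun H => H i (lt_top_iff_ne_top.2 hi) hir⟩
    · rintro ⟨⟨hi, hir⟩, hr, -⟩
      exact ⟨⟨hi, hr.2 hir⟩, hr, r.symm hir⟩
  have h3 : ∑ r ∈ ncBelow x with ¬ ∀ a < ⊤, ¬ r a ⊤, ∑ i ∈ (block r ⊤).erase ⊤,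
        weight t (restrict (· ≤ i) r) * weight t (restrict (¬ · ≤ i) r) =
      -(t * ∑ r ∈ ncBelow x with ¬ ∀ a < ⊤, ¬ r a ⊤, weight t r) := by
    rw [Finset.mul_sum, ← Finset.sum_neg_distrib]
    refine Finset.sum_congr rfl fun r hr => ?_
    rw [Finset.mem_filter, mem_ncBelow] at hr
    refine sum_weight_of_cut t hr.1.1 ?_
    have := hr.2
    push Not at this
    exact this
  rw [h1, h2, h3, weightSum,
    ← Finset.sum_filter_add_sum_filter_not (ncBelow x) (fun r => ∀ a < ⊤, ¬ r a ⊤),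
    sum_isolated_top]
  ring

end Recurrence

/-! ### The Möbius function -/

section Moebius

open Classical in
/-- For non-crossing `x`, the weights with `t = 1` satisfy the equations defining the Möbius
function `μ(0̂, ·)`. -/
theorem weightSum_one : ∀ (n : ℕ) {α : Type} [LinearOrder α] [Fintype α] (x : Setoid α),
    Fintype.card α = n → NonCrossing x → weightSum (1 : ℤ) x = if x = ⊥ then 1 else 0 := by
  intro n
  induction n using Nat.strong_induction_on with
  | _ n ih =>
  intro α _ _ x hn hx
  rcases isEmpty_or_nonempty α with hα | hα
  · have hsub : ∀ r s : Setoid α, r = s := fun r s => Setoid.ext fun a => hα.elim a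
    rw [if_pos (hsub _ _), weightSum, Finset.sum_eq_single x]
    · simp [weight]
    · exact fun r _ h => absurd (hsub r x) h
    · exact fun h => absurd (mem_ncBelow.2 ⟨hx, le_rfl⟩) h
  let _ : OrderTop α := Fintype.toOrderTop α
  have IH : ∀ (p : α → Prop) [Fintype {a // p a}], (∃ a, ¬ p a) →
      weightSum (1 : ℤ) (restrict p x) = if restrict p x = ⊥ then 1 else 0 := by
    intro p _ hp
    obtain ⟨a, ha⟩ := hp
    exact ih _ (hn ▸ Fintype.card_subtype_lt ha) _ rfl (hx.restrict p)
  have hbot : ∀ {p : α → Prop}, restrict p x = ⊥ ↔ ∀ a b, p a → p b → x a b → a = b := by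
    intro p
    rw [← le_bot_iff]
    constructor
    · intro h a b ha hb hab
      have : (⟨a, ha⟩ : {a // p a}) = ⟨b, hb⟩ := h (x := ⟨a, ha⟩) (y := ⟨b, hb⟩) hab
      exact congrArg Subtype.val this
    · intro h a b hab
      exact Subtype.ext (h a b a.2 b.2 hab)
  have hxbot : x = ⊥ ↔ ∀ a b, x a b → a = b := by
    rw [← le_bot_iff]
    exact ⟨fun h a b hab => h hab, fun h a b hab => h a b hab⟩
  have hrec := mul_weightSum (1 : ℤ) x
  rw [one_mul, one_pow, one_mul, IH (· < ⊤) ⟨⊤, lt_irrefl _⟩] at hrec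
  have hterm : ∀ i ∈ (block x ⊤).erase ⊤,
      weightSum (1 : ℤ) (restrict (· ≤ i) x) * weightSum (1 : ℤ) (restrict (¬ · ≤ i) x) =
        if restrict (· ≤ i) x = ⊥ ∧ restrict (¬ · ≤ i) x = ⊥ then 1 else 0 := by
    intro i hi
    rw [Finset.mem_erase] at hi
    rw [IH _ ⟨⊤, fun h => hi.1 (top_le_iff.1 h)⟩, IH _ ⟨i, fun h => h le_rfl⟩, ite_and]
    split_ifs <;> simp
  rw [hrec, Finset.sum_congr rfl hterm]
  by_cases hiso : ∀ a < ⊤, ¬ x a ⊤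
  · have hempty : (block x ⊤).erase ⊤ = ∅ := by
      refine Finset.eq_empty_of_forall_notMem fun a ha => ?_
      rw [Finset.mem_erase, mem_block] at ha
      exact hiso a (lt_top_iff_ne_top.2 ha.1) (x.symm ha.2)
    have hiff : restrict (· < ⊤) x = ⊥ ↔ x = ⊥ := by
      rw [hbot, hxbot]
      refine ⟨fun h a b hab => ?_, fun h a b _ _ hab => h a b hab⟩
      rcases (le_top : a ≤ ⊤).eq_or_lt with rfl | ha <;>
        rcases (le_top : b ≤ ⊤).eq_or_lt with rfl | hb
      · rfl
      · exact absurd (x.symm hab) (hiso b hb)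
      · exact absurd hab (hiso a ha)
      · exact h a b ha hb hab
    rw [hempty, Finset.sum_empty, sub_zero]
    simp only [hiff]
  · push Not at hiso
    obtain ⟨j, hj, hjt⟩ := hiso
    rw [if_neg fun h => hj.ne (hxbot.1 h j ⊤ hjt)]
    by_cases h0 : restrict (· < ⊤) x = ⊥
    -- `x` merges only `j` with `⊤`, and the cut after `j` is the only one
    · have hsingle : (block x ⊤).erase ⊤ = {j} := by
        ext a
        rw [Finset.mem_erase, mem_block, Finset.mem_singleton]
        constructor
        · rintro ⟨ha, hat⟩
          exact hbot.1 h0 a j (lt_top_iff_ne_top.2 ha) hj (x.trans (x.symm hat) (x.symm hjt))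
        · rintro rfl
          exact ⟨hj.ne, x.symm hjt⟩
      rw [hsingle, Finset.sum_singleton, if_pos h0, if_pos, sub_self]
      rw [hbot] at h0
      refine ⟨hbot.2 fun a b ha hb => h0 a b (ha.trans_lt hj) (hb.trans_lt hj), ?_⟩
      rw [hbot]
      intro a b ha hb hab
      have key : ∀ c, ¬ c ≤ j → ¬ x c ⊤ ∨ c = ⊤ := by
        intro c hc
        by_contra! H
        exact hc (h0 c j (lt_top_iff_ne_top.2 H.2) hj (x.trans H.1 (x.symm hjt))).le
      rcases (le_top : a ≤ ⊤).eq_or_lt with rfl | ha' <;>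
        rcases (le_top : b ≤ ⊤).eq_or_lt with rfl | hb'
      · rfl
      · exact ((key b hb).resolve_left fun H => H (x.symm hab)).symm
      · exact (key a ha).resolve_left fun H => H hab
      · exact h0 a b ha' hb' hab
    -- otherwise no cut leaves `0̂` on both sides
    · rw [if_neg h0, Finset.sum_eq_zero, sub_zero]
      intro i hi
      rw [Finset.mem_erase, mem_block] at hi
      refine if_neg fun H => h0 ?_
      obtain ⟨H1, H2⟩ := H
      rw [hbot] at H1 H2 ⊢
      have cross : ∀ a b, a ≤ i → ¬ b ≤ i → b < ⊤ → ¬ x a b := by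
        intro a b ha hb hbt hab
        have h1 := hx.rel_top_of_le_of_lt (x.symm hi.2) ha (not_le.1 hb) hab
        have hti : ¬ (⊤ : α) ≤ i := fun h => hi.1 (top_le_iff.1 h)
        exact hbt.ne (H2 b ⊤ hb hti (x.trans (x.symm hab) h1))
      intro a b ha hb hab
      by_cases hai : a ≤ i <;> by_cases hbi : b ≤ i
      · exact H1 a b hai hbi hab
      · exact absurd hab (cross a b hai hbi hb)
      · exact absurd (x.symm hab) (cross b a hbi hai ha)
      · exact H2 a b hai hbi hab

/-- The form through blocks of the non-crossing condition agrees with the relational one. -/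
theorem isNonCrossing_iff {n : ℕ} {r : Setoid (Fin n)} : IsNonCrossing r ↔ NonCrossing r := by
  constructor
  · intro h a b c d hab hbc hcd hac hbd
    by_contra hn
    refine h ⟨{y | r y a}, r.mem_classes a, {y | r y b}, r.mem_classes b, fun he => hn ?_, a, b, c,
      d, r.refl a, r.symm hac, r.refl b, r.symm hbd, hab, hbc, hcd⟩
    have : a ∈ {y | r y b} := he ▸ r.refl a
    exact this
  · rintro h ⟨B, ⟨p, rfl⟩, C, ⟨q, rfl⟩, hne, a, b, c, d, ha, hc, hb, hd, hab, hbc, hcd⟩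
    have h1 : r a b := h hab hbc hcd (r.trans ha (r.symm hc)) (r.trans hb (r.symm hd))
    have h2 : r p q := r.trans (r.symm ha) (r.trans h1 hb)
    exact hne (Set.ext fun y => ⟨fun hy => r.trans hy h2, fun hy => r.trans hy (r.symm h2)⟩)

open Classical in
theorem sum_moebius {L : Type*} [PartialOrder L] [OrderBot L] [Fintype L] (x : L) :
    ∑ y with y ≤ x, moebius ⊥ y = if ⊥ = x then 1 else 0 := by
  let _ : LocallyFiniteOrder L := Fintype.toLocallyFiniteOrder
  have h := IncidenceAlgebra.sum_Icc_mu_right (𝕜 := ℤ) (⊥ : L) x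
  rw [← h]
  refine Finset.sum_congr (by ext; simp) fun y _ => ?_
  unfold moebius
  congr!

open Classical in
theorem sum_le_eq_weightSum {R : Type*} [CommRing R] {n : ℕ} [Fintype (NC n)] (t : R) (x : NC n) :
    ∑ y : NC n with y ≤ x, weight t y.1 = weightSum t x.1 := by
  refine Finset.sum_bij (fun y _ => y.1) ?_ ?_ ?_ ?_
  · intro y hy
    exact mem_ncBelow.2 ⟨isNonCrossing_iff.1 y.2, (Finset.mem_filter.1 hy).2⟩
  · exact fun y _ z _ h => Subtype.ext h
  · intro r hr
    rw [mem_ncBelow] at hr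
    exact ⟨⟨r, isNonCrossing_iff.2 hr.1⟩, Finset.mem_filter.2 ⟨Finset.mem_univ _, hr.2⟩, rfl⟩
  · exact fun _ _ => rfl

/-- The Möbius function `μ(0̂, x)` is the product of signed Catalan numbers over the blocks of
`x`. -/
theorem moebius_bot {n : ℕ} (x : NC n) : moebius ⊥ x = weight (1 : ℤ) x.1 := by
  classical
  let _ := Fintype.ofFinite (NC n)
  induction x using WellFoundedLT.induction with
  | ind x ih =>
  have h1 := sum_moebius x
  have h2 := sum_le_eq_weightSum (1 : ℤ) x
  rw [weightSum_one _ x.1 rfl (isNonCrossing_iff.1 x.2)] at h2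
  have h3 : (⊥ = x) ↔ x.1 = ⊥ := ⟨fun h => h ▸ rfl, fun h => Subtype.ext h.symm⟩
  have hx : x ∈ Finset.univ.filter (· ≤ x) := by simp
  simp only [h3] at h1
  rw [← h2, ← Finset.add_sum_erase _ _ hx, ← Finset.add_sum_erase _ _ hx,
    Finset.sum_congr rfl fun y hy => ih y ?_] at h1
  · exact add_right_cancel h1
  · rw [Finset.mem_erase, Finset.mem_filter] at hy
    exact lt_of_le_of_ne hy.2.2 hy.1

end Moebius

/-! ### The rank function -/

section Rank

/-- A strictly monotone function that some lower element always decreases by one is the height. -/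
theorem rank_eq_of_strictMono {L : Type*} [PartialOrder L] [Finite L] {f : L → ℕ}
    (hf : StrictMono f) (h : ∀ x, f x ≠ 0 → ∃ y < x, f y + 1 = f x) (x : L) : rank x = f x := by
  have key : ∀ x, Order.height x = f x := by
    intro x
    induction x using WellFoundedLT.induction with
    | ind x ih =>
    refine le_antisymm (Order.height_le_coe_iff.2 fun y hy => ?_) ?_
    · rw [ih y hy]; exact_mod_cast hf hy
    · by_cases h0 : f x = 0
      · simp [h0]
      · obtain ⟨y, hy, hxy⟩ := h x h0
        rw [← hxy, Nat.cast_add, ← ih y hy]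
        exact_mod_cast Order.height_add_one_le hy
  rw [rank, key, ENat.toNat_natCast]

variable {α : Type} [LinearOrder α] [Fintype α]

theorem exists_isBlockMax (r : Setoid α) (a : α) : ∃ b, r a b ∧ IsBlockMax r b := by
  obtain ⟨b, hb, hmax⟩ := (block r a).exists_maximal ⟨a, mem_block.2 (r.refl a)⟩
  rw [mem_block] at hb
  refine ⟨b, hb, fun c hc => ?_⟩
  by_contra hn
  exact hn (hmax (mem_block.2 (r.trans hb hc)) (not_le.1 hn).le)

theorem card_blockMaxima_lt {r s : Setoid α} (h : r < s) :
    (blockMaxima s).card < (blockMaxima r).card := by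
  refine Finset.card_lt_card (Finset.ssubset_iff_subset_ne.2 ⟨fun a ha => ?_, fun he => ?_⟩)
  · rw [mem_blockMaxima] at ha ⊢
    exact fun b hb => ha b (h.le hb)
  · refine h.not_ge fun a b hab => ?_
    obtain ⟨c, hac, hc⟩ := exists_isBlockMax r a
    obtain ⟨d, hbd, hd⟩ := exists_isBlockMax r b
    have hc' : IsBlockMax s c := mem_blockMaxima.1 (he ▸ mem_blockMaxima.2 hc)
    have hd' : IsBlockMax s d := mem_blockMaxima.1 (he ▸ mem_blockMaxima.2 hd)
    have hcd : s c d := s.trans (s.symm (h.le hac)) (s.trans hab (h.le hbd))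
    have : c = d := le_antisymm (hd' c (s.symm hcd)) (hc' d hcd)
    subst this
    exact r.trans hac (r.symm hbd)

/-- The partition obtained from `r` by turning `a` into a singleton block. -/
def isolate {γ : Type} (r : Setoid γ) (a : γ) : Setoid γ where
  r b c := b = c ∨ (b ≠ a ∧ c ≠ a ∧ r b c)
  iseqv :=
    { refl := fun b => Or.inl rfl
      symm := by
        rintro b c (rfl | ⟨hb, hc, h⟩)
        · exact Or.inl rfl
        · exact Or.inr ⟨hc, hb, r.symm h⟩
      trans := by
        rintro b c d (rfl | ⟨hb, hc, h⟩) (rfl | ⟨hc', hd, h'⟩)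
        · exact Or.inl rfl
        · exact Or.inr ⟨hc', hd, h'⟩
        · exact Or.inr ⟨hb, hc, h⟩
        · exact Or.inr ⟨hb, hd, r.trans h h'⟩ }

theorem isolate_rel {γ : Type} {r : Setoid γ} {a b c : γ} :
    isolate r a b c ↔ b = c ∨ (b ≠ a ∧ c ≠ a ∧ r b c) :=
  Iff.rfl

theorem isolate_le {γ : Type} (r : Setoid γ) (a : γ) : isolate r a ≤ r := by
  rintro b c (rfl | ⟨-, -, h⟩)
  · exact r.refl _
  · exact h

theorem NonCrossing.isolate {γ : Type} [LinearOrder γ] {r : Setoid γ} (h : NonCrossing r)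
    (a : γ) :
    NonCrossing (isolate r a) := by
  intro p q s t hpq hqs hst hps hqt
  obtain ⟨hp, -, hps⟩ := (isolate_rel.1 hps).resolve_left (hpq.trans hqs).ne
  obtain ⟨hq, -, hqt⟩ := (isolate_rel.1 hqt).resolve_left (hqs.trans hst).ne
  exact Or.inr ⟨hp, hq, h hpq hqs hst hps hqt⟩

theorem card_blockMaxima_isolate {r : Setoid α} {a : α} (ha : ¬ IsBlockMax r a) :
    (blockMaxima (isolate r a)).card = (blockMaxima r).card + 1 := by
  classical
  have ha' : a ∉ blockMaxima r := fun h => ha (mem_blockMaxima.1 h)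
  rw [← Finset.card_insert_of_notMem ha']
  congr 1
  ext b
  rw [Finset.mem_insert, mem_blockMaxima, mem_blockMaxima]
  constructor
  · intro hb
    by_cases hba : b = a
    · exact Or.inl hba
    refine Or.inr fun c hc => ?_
    by_cases hca : c = a
    -- `a` lies below another element of the block of `b`, which `b` dominates
    · subst hca
      unfold IsBlockMax at ha
      push Not at ha
      obtain ⟨d, hd, hcd⟩ := ha
      exact hcd.le.trans (hb d (Or.inr ⟨hba, hcd.ne', r.trans hc hd⟩))
    · exact hb c (Or.inr ⟨hba, hca, hc⟩)
  · rintro (rfl | hb) c hc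
    · rcases hc with rfl | ⟨h, -⟩
      · exact le_rfl
      · exact absurd rfl h
    · exact hb c (isolate_le r a hc)

/-- The rank of a non-crossing partition is `n` minus its number of blocks: isolating an element
that is not the largest of its block creates no crossing and adds exactly one block. -/
theorem rank_nc {n : ℕ} (x : NC n) : rank x = n - (blockMaxima x.1).card := by
  have hle : ∀ x : NC n, (blockMaxima x.1).card ≤ n := fun x =>
    (Finset.card_le_univ _).trans_eq (Fintype.card_fin n)
  refine rank_eq_of_strictMono (f := fun x : NC n => n - (blockMaxima x.1).card) ?_ ?_ x
  · intro x y hxy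
    have := card_blockMaxima_lt (r := x.1) (s := y.1) hxy
    have := hle x
    show n - _ < n - _
    omega
  · intro x hx
    obtain ⟨a, ha⟩ : ∃ a, ¬ IsBlockMax x.1 a := by
      by_contra! H
      refine hx ?_
      have : blockMaxima x.1 = Finset.univ := by ext a; simp [mem_blockMaxima, H a]
      simp [this]
    have hcard := card_blockMaxima_isolate ha
    have hnc := isNonCrossing_iff.2 ((isNonCrossing_iff.1 x.2).isolate a)
    refine ⟨⟨isolate x.1 a, hnc⟩, lt_of_le_of_ne (isolate_le x.1 a) fun he => ?_, ?_⟩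
    · have he' : isolate x.1 a = x.1 := congrArg Subtype.val he
      rw [he'] at hcard
      omega
    · have := hle ⟨isolate x.1 a, hnc⟩
      simp only at this hx ⊢
      omega

theorem blockMaxima_top [OrderTop α] : blockMaxima (⊤ : Setoid α) = {⊤} := by
  ext a
  rw [mem_blockMaxima, Finset.mem_singleton]
  exact ⟨fun h => top_le_iff.1 (h ⊤ trivial), fun h b _ => h ▸ le_top⟩

end Rank

/-! ### The characteristic polynomial -/

/-- The weight `weight X r` carries one factor `X` per block, whereas the exponent in the
characteristic polynomial is the number of blocks minus one. -/
theorem X_mul_charPoly (n : ℕ) : X * charPoly (NC (n + 1)) =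
    weightSum (X : ℤ[X]) (⊤ : Setoid (Fin (n + 1))) := by
  classical
  let _ := Fintype.ofFinite (NC (n + 1))
  show X * charPoly (NC (n + 1)) = weightSum (X : ℤ[X]) (⊤ : NC (n + 1)).1
  rw [← sum_le_eq_weightSum (X : ℤ[X]) (⊤ : NC (n + 1)), charPoly, Finset.mul_sum,
    Finset.filter_true_of_mem fun _ _ => le_top]
  refine Finset.sum_congr rfl fun y _ => ?_
  have hpos : 0 < (blockMaxima y.1).card := by
    obtain ⟨b, -, hb⟩ := exists_isBlockMax y.1 0
    exact Finset.card_pos.2 ⟨b, mem_blockMaxima.2 hb⟩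
  have hle : (blockMaxima y.1).card ≤ n + 1 :=
    (Finset.card_le_univ _).trans_eq (Fintype.card_fin _)
  have htop : (blockMaxima (⊤ : NC (n + 1)).1).card = 1 := by
    show (blockMaxima (⊤ : Setoid (Fin (n + 1)))).card = 1
    rw [blockMaxima_top, Finset.card_singleton]
  rw [rank_nc, rank_nc, htop, weight_eq_mul_pow, moebius_bot, eq_intCast,
    mul_left_comm, ← pow_succ']
  congr 2
  omega

/-- The weighted sum over all non-crossing partitions only depends on the number of elements. -/
theorem weightSum_top {α : Type} [LinearOrder α] [Fintype α] {n : ℕ}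
    (h : Fintype.card α = n + 1) :
    weightSum (X : ℤ[X]) (⊤ : Setoid α) = X * charPoly (NC (n + 1)) := by
  rw [X_mul_charPoly, ← weightSum_comap_orderIso _ _ (Fintype.orderIsoFinOfCardEq α h)]
  congr 1

theorem charPoly_nc_recurrence (m : ℕ) :
    charPoly (NC (m + 2)) = X * charPoly (NC (m + 1)) -
      ∑ k ∈ Finset.range (m + 1), charPoly (NC (k + 1)) * charPoly (NC (m + 2 - (k + 1))) := by
  classical
  have hrec := mul_weightSum (X : ℤ[X]) (⊤ : Setoid (Fin (m + 2)))
  have hblock : (block (⊤ : Setoid (Fin (m + 2))) ⊤).erase ⊤ = Finset.univ.erase (Fin.last _) := by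
    ext a
    simp only [Finset.mem_erase, mem_block, Finset.mem_univ]
    exact and_congr_right fun _ => iff_of_true trivial trivial
  have hterm : ∀ i : Fin (m + 1),
      weightSum (X : ℤ[X]) (restrict (· ≤ i.castSucc) ⊤) *
        weightSum (X : ℤ[X]) (restrict (¬ · ≤ i.castSucc) ⊤) =
      X ^ 2 * (charPoly (NC (i + 1)) * charPoly (NC (m + 2 - (i + 1)))) := by
    intro i
    have hc : Fintype.card {a : Fin (m + 2) // a ≤ i.castSucc} = i + 1 := by
      rw [Fintype.card_of_subtype (Finset.Iic i.castSucc) (by simp), Fin.card_Iic, Fin.val_castSucc]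
    have hc' : Fintype.card {a : Fin (m + 2) // ¬ a ≤ i.castSucc} = m - i + 1 := by
      rw [Fintype.card_subtype_compl, hc, Fintype.card_fin]; omega
    have h1 := weightSum_top hc
    have h2 := weightSum_top hc'
    rw [show m + 2 - (i.1 + 1) = m - i + 1 by omega]
    have h3 : ∀ p : Fin (m + 2) → Prop, restrict p ⊤ = ⊤ := fun p => rfl
    rw [h3, h3, h1, h2]
    ring
  have hlt : weightSum (X : ℤ[X]) (restrict (· < ⊤) (⊤ : Setoid (Fin (m + 2)))) =
      X * charPoly (NC (m + 1)) := by
    refine weightSum_top ?_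
    rw [Fintype.card_of_subtype (Finset.Iio ⊤) (by simp), Fin.card_Iio, Fin.top_eq_last,
      Fin.val_last]
  have hsum : ∑ i ∈ (block (⊤ : Setoid (Fin (m + 2))) ⊤).erase ⊤,
        weightSum (X : ℤ[X]) (restrict (· ≤ i) ⊤) * weightSum (X : ℤ[X]) (restrict (¬ · ≤ i) ⊤) =
      X ^ 2 * ∑ k ∈ Finset.range (m + 1),
        charPoly (NC (k + 1)) * charPoly (NC (m + 2 - (k + 1))) := by
    have herase : Finset.univ.erase (Fin.last (m + 1)) =
        (Finset.univ : Finset (Fin (m + 1))).map Fin.castSuccEmb := by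
      ext a
      simp [Fin.exists_castSucc_eq]
    rw [hblock, herase, Finset.sum_map, Finset.mul_sum,
      Finset.sum_range fun k => X ^ 2 * (charPoly (NC (k + 1)) * charPoly (NC (m + 2 - (k + 1))))]
    exact Finset.sum_congr rfl fun i _ => hterm i
  rw [hsum, hlt, weightSum_top (Fintype.card_fin (m + 2))] at hrec
  refine mul_left_cancel₀ (pow_ne_zero 2 (X_ne_zero (R := ℤ))) ?_
  linear_combination hrec

theorem charPoly_nc_one : charPoly (NC 1) = 1 := by
  refine mul_left_cancel₀ (X_ne_zero (R := ℤ)) ?_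
  have hsub : ∀ r s : Setoid (Fin 1), r = s := fun r s => Setoid.ext fun a b => by
    rw [Subsingleton.elim a b]; exact iff_of_true (r.refl _) (s.refl _)
  rw [X_mul_charPoly, weightSum, Finset.sum_eq_single ⊤, mul_one]
  · have hiso : ∀ a < (⊤ : Fin 1), ¬ (⊤ : Setoid (Fin 1)) a ⊤ :=
      fun a ha => absurd (Subsingleton.elim a ⊤) ha.ne
    have : IsEmpty {a : Fin 1 // a < ⊤} := ⟨fun a => a.2.ne (Subsingleton.elim _ _)⟩
    rw [weight_of_isolated_top _ hiso]
    simp [weight]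
  · exact fun r _ h => absurd (hsub r ⊤) h
  · exact fun h => absurd (mem_ncBelow.2 ⟨isNonCrossing_iff.1 (isNonCrossing_top 1), le_rfl⟩) h

theorem moebius_bot_top (m : ℕ) : moebius (⊥ : NC (m + 1)) ⊤ = (-1) ^ m * (catalan m : ℤ) := by
  rw [moebius_bot]
  show weight (1 : ℤ) (⊤ : Setoid (Fin (m + 1))) = _
  have hblock : block (⊤ : Setoid (Fin (m + 1))) ⊤ = Finset.univ := by
    ext a
    rw [mem_block]
    exact iff_of_true trivial (Finset.mem_univ a)
  rw [weight, Finset.prod_eq_single ⊤]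
  · rw [localWeight_of_isBlockMax fun b _ => le_top, hblock]
    simp [blockWeight]
  · exact fun a _ ha => localWeight_of_lt (b := ⊤) trivial (lt_top_iff_ne_top.2 ha)
  · exact fun h => absurd (Finset.mem_univ _) h

/-- Only the term of `1̂` survives at `t = 0`, because the rank is strictly monotone. -/
theorem eval_zero_charPoly_nc (n : ℕ) :
    (charPoly (NC n)).eval 0 = moebius (⊥ : NC n) ⊤ := by
  classical
  let _ := Fintype.ofFinite (NC n)
  rw [charPoly, eval_finsetSum, Finset.sum_eq_single ⊤]
  · simp
  · intro x _ hx
    have hlt : rank x < rank (⊤ : NC n) := by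
      have h1 := card_blockMaxima_lt (r := x.1) (s := (⊤ : NC n).1)
        (show x < ⊤ from lt_top_iff_ne_top.2 hx)
      have h2 : (blockMaxima x.1).card ≤ n :=
        (Finset.card_le_univ _).trans_eq (Fintype.card_fin n)
      rw [rank_nc, rank_nc]
      omega
    simp [zero_pow (Nat.sub_ne_zero_of_lt hlt)]
  · exact fun h => absurd (Finset.mem_univ _) h

theorem proposition13 :
    charPoly (NC 1) = 1 ∧
    (∀ n : ℕ, 2 ≤ n →
      charPoly (NC n) = X * charPoly (NC (n - 1)) -
        ∑ i ∈ Finset.Icc 1 (n - 1), charPoly (NC i) * charPoly (NC (n - i))) ∧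
    (∀ n : ℕ, 1 ≤ n →
      (charPoly (NC n)).eval 0 = moebius (⊥ : NC n) ⊤ ∧
      moebius (⊥ : NC n) ⊤ = (-1) ^ (n - 1) * (catalan (n - 1) : ℤ)) := by
  refine ⟨charPoly_nc_one, fun n hn => ?_, fun n hn => ⟨eval_zero_charPoly_nc n, ?_⟩⟩
  · obtain ⟨m, rfl⟩ := Nat.exists_eq_add_of_le' hn
    rw [charPoly_nc_recurrence, Finset.range_eq_Ico,
      Finset.sum_Ico_add' (fun i => charPoly (NC i) * charPoly (NC (m + 2 - i)))]
    rfl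
  · obtain ⟨m, rfl⟩ := Nat.exists_eq_add_of_le' hn
    exact moebius_bot_top m
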